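/- Let $(X,d)$ be a nonempty complete separable metric space, and let $\mathcal{F}=(X;(f_i,p_i):i\in I)$, $I$ finite, be a probabilistic iterated function system: the maps $f_i:X\to X$ are continuous, $p_i\in[0,1]$ and $\sum_{i\in I}p_i=1$. Assume that $p_i>0$ and that $f_i$ is Lipschitz for every $i\in I$. For $k\ge 1$ let $\mathcal{F}^k=(X;(f_{\underline{i}},p_{\underline{i}}):\underline{i}\in I^k)$ be the $k$-th iterate, where for $\underline{i}=(i_1,\dots,i_k)$ one puts $f_{\underline{i}}=f_{i_1}\circ\dots\circ f_{i_k}$ and $p_{\underline{i}}=\prod_{l=1}^k p_{i_l}$. Suppose that, for some $k\geq 1$, $\mathcal{F}^k$ is average contractive: $$\sum_{\underline{i}\in I^k}p_{\underline{i}}\cdot\operatorname{Lip}(f_{\underline{i}})<1,$$ where $\operatorname{Lip}(f)$ is the smallest Lipschitz constant of $f$. For a system $\mathcal{G}=(X;(g_j,q_j):j\in J)$ let $G(S)=\overline{\bigcup_{j\in J}g_j(S)}$, $S\subseteq X$, be its Hutchinson operator. A semiattractor of $\mathcal{G}$ is a nonempty closed set $A\subseteq X$ with $\bigcap_{x\in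 X}\operatorname{Li}_n G^n(\{x\})=A$, where $\operatorname{Li}_n S_n$ is the set of limits of convergent sequences $(x_n)_{n\ge1}$ with $x_n\in S_n$ for all $n\ge 1$. The Markov operator of $\mathcal{G}$ is $\mu\mapsto\sum_{j\in J}q_j\,\mu\circ g_j^{-1}$ on the Borel probability measures on $X$. A Markov operator $M$ is asymptotically stable, with asymptotically stable measure $\mu_*$, if $M^n\nu\to\mu_*$ weakly for every Borel probability measure $\nu$ on $X$. Then: (a) $\mathcal{F}$ and $\mathcal{F}^k$ admit semiattractors, and these coincide; denote the common semiattractor by $A_*$. (b) The Markov operator of $\mathcal{F}^k$ is $M^k$, where $M$ is the Markov operator of $\mathcal{F}$. Both $M$ and $M^k$ are asymptotically stable, with the same asymptotically stable measure $\mu_*$; this $\mu_*$ is the unique invariant Borel probability measure of $M$ and the unique invariant Borel probability measure of $M^k$; and $\operatorname{supp}\mu_*=A_*$. -/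

import Mathlib

open Set Filter Topology MeasureTheory
open scoped NNReal ENNReal

/-- An iterated function system: continuous self-maps of `X` indexed by `I`
(the index set is taken finite wherever the notion is used). -/
structure IFS (X : Type*) [TopologicalSpace X] (I : Type*) where
  map : I → X → X
  continuous_map : ∀ i, Continuous (map i)

/-- A probabilistic iterated function system: an IFS with a probability vector. -/
structure ProbIFS (X : Type*) [TopologicalSpace X] (I : Type*) [Fintype I] extends IFS X I where
  prob : I → ℝ≥0
  sum_prob : ∑ i, prob i = 1

/-- The (best) Lipschitz constant of `f`, with value `∞` when `f` is not Lipschitz.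
The terms with `x = y` contribute `0 / 0 = 0`. -/
noncomputable def lipConst {X : Type*} [MetricSpace X] (f : X → X) : ℝ≥0∞ :=
  ⨆ x, ⨆ y, edist (f x) (f y) / edist x y

/-- The lower Kuratowski limit of a sequence of sets `S n`, `n ≥ 1`. -/
def lowerKuratowskiLimit {X : Type*} [TopologicalSpace X] (S : ℕ → Set X) : Set X :=
  {y | ∃ x : ℕ → X, (∀ n, 1 ≤ n → x n ∈ S n) ∧ Tendsto x atTop (𝓝 y)}

namespace IFS

variable {X : Type*} [TopologicalSpace X] {I : Type*}

/-- The Hutchinson operator on the power set of `X`. -/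
def hutchinson (F : IFS X I) (S : Set X) : Set X :=
  closure (⋃ i, F.map i '' S)

/-- `A` is a semiattractor of `F`: a nonempty closed set equal to the intersection over
all `x` of the lower Kuratowski limits of the orbits `F^n({x})`. -/
def IsSemiattractor (F : IFS X I) (A : Set X) : Prop :=
  A.Nonempty ∧ IsClosed A ∧
    ⋂ x : X, lowerKuratowskiLimit (fun n => F.hutchinson^[n] {x}) = A

/-- `f_{w 0} ∘ f_{w 1} ∘ ⋯ ∘ f_{w (k-1)}`. -/
def wordMap (F : IFS X I) : {k : ℕ} → (Fin k → I) → X → X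
  | 0, _ => id
  | _ + 1, w => F.map (w 0) ∘ F.wordMap (Fin.tail w)

theorem continuous_wordMap (F : IFS X I) {k : ℕ} (w : Fin k → I) :
    Continuous (F.wordMap w) := by
  induction k with
  | zero => exact continuous_id
  | succ k ih => exact (F.continuous_map (w 0)).comp (ih (Fin.tail w))

/-- The `k`-th iterate of an IFS, indexed by words of length `k`. -/
def iterate (F : IFS X I) (k : ℕ) : IFS X (Fin k → I) where
  map w := F.wordMap w
  continuous_map w := F.continuous_wordMap w

end IFS

namespace ProbIFS

variable {X : Type*} [TopologicalSpace X] {I : Type*} [Fintype I]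

/-- The `k`-th iterate of a probabilistic IFS: the word `w` has probability `∏ l, p_{w l}`. -/
def iterate (F : ProbIFS X I) (k : ℕ) : ProbIFS X (Fin k → I) where
  toIFS := F.toIFS.iterate k
  prob w := ∏ l, F.prob (w l)
  sum_prob := by
    classical
    rw [← Fintype.sum_pow, F.sum_prob, one_pow]

/-- The Markov operator `μ ↦ ∑ i, p i • (μ ∘ (f i)⁻¹)` on Borel probability measures. -/
noncomputable def markov [MeasurableSpace X] [BorelSpace X] (F : ProbIFS X I)
    (μ : ProbabilityMeasure X) : ProbabilityMeasure X :=
  ⟨∑ i, F.prob i • (μ : Measure X).map (F.map i), ⟨by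
    have h : ∀ i, (μ : Measure X).map (F.map i) univ = 1 := fun i => by
      rw [Measure.map_apply (F.continuous_map i).measurable MeasurableSet.univ]
      simp
    simp only [Measure.finsetSum_apply, Measure.smul_apply, h, ENNReal.smul_def, smul_eq_mul,
      mul_one]
    exact_mod_cast F.sum_prob⟩⟩

end ProbIFS

section Stability

variable {X : Type*} [TopologicalSpace X] [MeasurableSpace X] [OpensMeasurableSpace X]

/-- `μ` is an asymptotically stable measure of the operator `M`: the iterates of `M` at every
probability measure converge weakly to `μ` (the topology of `ProbabilityMeasure X` is that of
weak convergence). -/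
def IsAsymptoticallyStableMeasure (M : ProbabilityMeasure X → ProbabilityMeasure X)
    (μ : ProbabilityMeasure X) : Prop :=
  ∀ ν : ProbabilityMeasure X, Tendsto (fun n => M^[n] ν) atTop (𝓝 μ)

end Stability

/-- `μ` is the unique invariant probability measure of the operator `M`. -/
def IsUniqueInvariantMeasure {X : Type*} [MeasurableSpace X]
    (M : ProbabilityMeasure X → ProbabilityMeasure X) (μ : ProbabilityMeasure X) : Prop :=
  M μ = μ ∧ ∀ ν : ProbabilityMeasure X, M ν = ν → ν = μ

theorem edist_le_lipConst_mul {X : Type*} [MetricSpace X] (f : X → X) (x y : X) :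
    edist (f x) (f y) ≤ lipConst f * edist x y := by
  rcases eq_or_ne x y with rfl | hxy
  · simp
  · rw [← ENNReal.div_le_iff (edist_pos.2 hxy).ne' (edist_ne_top x y)]
    exact le_iSup₂ (f := fun x y => edist (f x) (f y) / edist x y) x y

namespace IFS

variable {X : Type*} [TopologicalSpace X] {I : Type*}

theorem wordMap_eq_init_last (F : IFS X I) {n : ℕ} (w : Fin (n + 1) → I) (x : X) :
    F.wordMap w x = F.wordMap (Fin.init w) (F.map (w (Fin.last n)) x) := by
  induction n with
  | zero => simp [wordMap]
  | succ n ih =>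
    change F.map (w 0) (F.wordMap (Fin.tail w) x) =
      F.map (Fin.init w 0) (F.wordMap (Fin.tail (Fin.init w)) (F.map (w (Fin.last _)) x))
    rw [ih, Fin.tail_init_eq_init_tail]
    simp [Fin.init, Fin.tail]

theorem hutchinson_iterate_singleton [T1Space X] [Finite I] (F : IFS X I) (n : ℕ) (x : X) :
    F.hutchinson^[n] {x} = range fun w : Fin n → I => F.wordMap w x := by
  induction n with
  | zero => simp [wordMap]
  | succ n ih =>
    rw [Function.iterate_succ_apply', ih, hutchinson,
      (Set.finite_iUnion fun i => (Set.finite_range _).image _).isClosed.closure_eq]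
    ext y
    simp only [mem_iUnion, mem_image, mem_range, exists_exists_eq_and]
    constructor
    · rintro ⟨i, w, rfl⟩
      exact ⟨Fin.cons i w, by simp [wordMap]⟩
    · rintro ⟨w, rfl⟩
      exact ⟨w 0, Fin.tail w, rfl⟩

end IFS

/-- A point lies in the lower Kuratowski limit of nonempty sets as soon as each of its
neighbourhoods eventually meets them. -/
theorem mem_lowerKuratowskiLimit_of_eventually {X : Type*} [PseudoMetricSpace X]
    {S : ℕ → Set X} {y : X} (hne : ∀ n, (S n).Nonempty)
    (h : ∀ ε > 0, ∀ᶠ n in atTop, (S n ∩ Metric.ball y ε).Nonempty) :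
    y ∈ lowerKuratowskiLimit S := by
  have hx : ∀ n : ℕ, ∃ x ∈ S n, dist y x < Metric.infDist y (S n) + 1 / ((n : ℝ) + 1) := fun n =>
    (Metric.infDist_lt_iff (hne n)).1 (lt_add_of_pos_right _ Nat.one_div_pos_of_nat)
  choose x hxS hxd using hx
  refine ⟨x, fun n _ => hxS n, ?_⟩
  have hinf : Tendsto (fun n => Metric.infDist y (S n)) atTop (𝓝 0) := by
    refine Metric.tendsto_nhds.2 fun ε hε => (h ε hε).mono ?_
    rintro n ⟨z, hz, hzb⟩
    rw [Real.dist_eq, sub_zero, abs_of_nonneg Metric.infDist_nonneg]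
    exact (Metric.infDist_le_dist_of_mem hz).trans_lt (by simpa [dist_comm] using hzb)
  rw [tendsto_iff_dist_tendsto_zero]
  have hsum := hinf.add (tendsto_one_div_add_atTop_nhds_zero_nat (𝕜 := ℝ))
  rw [add_zero] at hsum
  exact squeeze_zero (fun _ => dist_nonneg) (fun n => (dist_comm _ _).trans_le (hxd n).le) hsum

section Stability

variable {X : Type*} [TopologicalSpace X] [MeasurableSpace X]

theorem IsAsymptoticallyStableMeasure.isUniqueInvariantMeasure [HasOuterApproxClosed X] [BorelSpace X]
    {M : ProbabilityMeasure X → ProbabilityMeasure X} {μ : ProbabilityMeasure X}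
    (h : IsAsymptoticallyStableMeasure M μ) (hμ : M μ = μ) : IsUniqueInvariantMeasure M μ := by
  refine ⟨hμ, fun ν hν => tendsto_nhds_unique ?_ (h ν)⟩
  simp only [Function.iterate_fixed hν, tendsto_const_nhds]

theorem IsAsymptoticallyStableMeasure.isFixedPt [HasOuterApproxClosed X] [BorelSpace X]
    {M : ProbabilityMeasure X → ProbabilityMeasure X} {μ : ProbabilityMeasure X}
    (h : IsAsymptoticallyStableMeasure M μ) (hM : Continuous M) : M μ = μ :=
  isFixedPt_of_tendsto_iterate (h μ) hM.continuousAt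

theorem IsAsymptoticallyStableMeasure.iterate [OpensMeasurableSpace X]
    {M : ProbabilityMeasure X → ProbabilityMeasure X} {μ : ProbabilityMeasure X}
    (h : IsAsymptoticallyStableMeasure M μ) {k : ℕ} (hk : 1 ≤ k) :
    IsAsymptoticallyStableMeasure M^[k] μ := fun ν => by
  simp only [← Function.iterate_mul]
  exact (h ν).comp (tendsto_id.const_mul_atTop' hk)

end Stability

namespace ProbIFS

section Markov

variable {X : Type*} [TopologicalSpace X] {I : Type*} [Fintype I]
  [MeasurableSpace X] [BorelSpace X]

theorem coe_markov (F : ProbIFS X I) (μ : ProbabilityMeasure X) :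
    (F.markov μ : Measure X) = ∑ i, F.prob i • (μ : Measure X).map (F.map i) := rfl

theorem iterate_markov (F : ProbIFS X I) (n : ℕ) : (F.iterate n).markov = F.markov^[n] := by
  induction n with
  | zero =>
    funext μ
    refine Subtype.ext ?_
    change ((F.iterate 0).markov μ : Measure X) = μ
    rw [coe_markov]
    simp [iterate, IFS.iterate, IFS.wordMap]
  | succ n ih =>
    funext μ
    rw [Function.iterate_succ_apply', ← ih]
    refine Subtype.ext ?_
    change ((F.iterate (n + 1)).markov μ : Measure X) =
      (F.markov ((F.iterate n).markov μ) : Measure X)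
    simp only [coe_markov, ← (Fin.consEquiv fun _ : Fin (n + 1) => I).sum_comp,
      Fintype.sum_prod_type]
    refine Finset.sum_congr rfl fun i _ => ?_
    rw [← Measure.mapₗ_apply_of_measurable (F.continuous_map i).measurable, map_sum,
      Finset.smul_sum]
    refine Finset.sum_congr rfl fun w _ => ?_
    have hw : (F.iterate (n + 1)).map (Fin.cons i w) = F.map i ∘ (F.iterate n).map w := by
      funext x; simp [iterate, IFS.iterate, IFS.wordMap]
    have hp : (F.iterate (n + 1)).prob (Fin.cons i w) = F.prob i * (F.iterate n).prob w := by
      simp [iterate, Fin.prod_univ_succ]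
    change (F.iterate (n + 1)).prob (Fin.cons i w) •
      (μ : Measure X).map ((F.iterate (n + 1)).map (Fin.cons i w)) = _
    rw [hw, hp, ← Measure.map_map (F.continuous_map i).measurable
      ((F.iterate n).continuous_map w).measurable, mul_smul,
      ← Measure.mapₗ_apply_of_measurable (F.continuous_map i).measurable]
    congr 1
    simp only [ENNReal.smul_def, map_smul]

theorem integral_markov (F : ProbIFS X I) (μ : ProbabilityMeasure X)
    (g : BoundedContinuousFunction X ℝ) :
    ∫ x, g x ∂(F.markov μ : Measure X) =
      ∑ i, (F.prob i : ℝ) * ∫ x, g (F.map i x) ∂(μ : Measure X) := by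
  have hint : ∀ i, Integrable g ((μ : Measure X).map (F.map i)) := fun i =>
    haveI := Measure.isProbabilityMeasure_map (μ := (μ : Measure X))
      (F.continuous_map i).measurable.aemeasurable
    g.integrable _
  rw [coe_markov, integral_finsetSum_measure fun i _ => (hint i).smul_measure_nnreal]
  refine Finset.sum_congr rfl fun i _ => ?_
  rw [integral_smul_nnreal_measure,
    integral_map (F.continuous_map i).measurable.aemeasurable
      g.continuous.measurable.aestronglyMeasurable]
  rfl

theorem continuous_markov (F : ProbIFS X I) : Continuous F.markov := by
  refine continuous_iff_continuousAt.2 fun μ =>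
    ProbabilityMeasure.tendsto_iff_forall_integral_tendsto.2 fun g => ?_
  simp only [integral_markov]
  exact tendsto_finsetSum _ fun i _ => (ProbabilityMeasure.tendsto_iff_forall_integral_tendsto.1
    (tendsto_id (x := 𝓝 μ)) (g.compContinuous ⟨F.map i, F.continuous_map i⟩)).const_mul _

theorem map_mem_support (F : ProbIFS X I) (hpos : ∀ i, 0 < F.prob i) {μ : ProbabilityMeasure X}
    (hμ : F.markov μ = μ) (i : I) {x : X} (hx : x ∈ (μ : Measure X).support) :
    F.map i x ∈ (μ : Measure X).support := by
  rw [Measure.support_eq_forall_isOpen] at hx ⊢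
  intro U hxU hU
  have hpre := hx _ hxU (hU.preimage (F.continuous_map i))
  rw [← hμ, coe_markov, Measure.finsetSum_apply]
  refine lt_of_lt_of_le ?_ (Finset.single_le_sum (fun _ _ => zero_le) (Finset.mem_univ i))
  rw [Measure.smul_apply, Measure.map_apply (F.continuous_map i).measurable hU.measurableSet,
    ENNReal.smul_def, smul_eq_mul]
  exact ENNReal.mul_pos (by exact_mod_cast (hpos i).ne') hpre.ne'

end Markov

/-- If the Markov operator of a system with positive probabilities is asymptotically stable,
then the support of the stable measure is the semiattractor. -/
theorem isSemiattractor_support {X : Type*} [MetricSpace X] [SecondCountableTopology X]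
    [MeasurableSpace X] [BorelSpace X] {I : Type*} [Fintype I] (F : ProbIFS X I)
    (hpos : ∀ i, 0 < F.prob i) {μ : ProbabilityMeasure X}
    (hμ : IsAsymptoticallyStableMeasure F.markov μ) :
    F.toIFS.IsSemiattractor (μ : Measure X).support := by
  have hne : (μ : Measure X).support.Nonempty :=
    Measure.nonempty_support (IsProbabilityMeasure.ne_zero _)
  have : Nonempty I := by
    by_contra h
    rw [not_nonempty_iff] at h
    simpa using F.sum_prob
  refine ⟨hne, Measure.isClosed_support, Subset.antisymm (fun y hy => ?_) (fun y hy => ?_)⟩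
  · obtain ⟨x, hx⟩ := hne
    obtain ⟨z, hz, hzy⟩ := mem_iInter.1 hy x
    refine Measure.isClosed_support.mem_of_tendsto hzy
      (eventually_atTop.2 ⟨1, fun n hn => ?_⟩)
    have hzn := hz n hn
    simp only [IFS.hutchinson_iterate_singleton] at hzn
    obtain ⟨w, hw⟩ := hzn
    rw [← hw]
    clear hw hz hn
    induction n with
    | zero => exact hx
    | succ n ih =>
      exact F.map_mem_support hpos (hμ.isFixedPt F.continuous_markov) _ (ih (Fin.tail w))
  · refine mem_iInter.2 fun x => ?_
    simp only [IFS.hutchinson_iterate_singleton]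
    refine mem_lowerKuratowskiLimit_of_eventually (fun n => range_nonempty _) fun ε hε => ?_
    have hball : 0 < (μ : Measure X) (Metric.ball y ε) :=
      (Measure.mem_support_iff_forall y).1 hy _ (Metric.ball_mem_nhds y hε)
    obtain ⟨δ, hδ⟩ : ∃ δ : ProbabilityMeasure X, (δ : Measure X) = Measure.dirac x :=
      ⟨⟨Measure.dirac x, inferInstance⟩, rfl⟩
    have hlim := ProbabilityMeasure.le_liminf_measure_open_of_tendsto
      (hμ δ) (Metric.isOpen_ball (x := y) (ε := ε))
    filter_upwards [eventually_lt_of_lt_liminf (hball.trans_le hlim)] with n hn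
    by_contra hcon
    refine hn.ne' ?_
    rw [← iterate_markov, coe_markov, Measure.finsetSum_apply]
    refine Finset.sum_eq_zero fun w _ => ?_
    rw [Measure.smul_apply, hδ,
      Measure.map_dirac' ((F.iterate n).continuous_map w).measurable,
      Measure.dirac_apply' _ Metric.isOpen_ball.measurableSet, indicator_of_notMem, smul_zero]
    exact fun hmem => hcon ⟨_, ⟨w, rfl⟩, hmem⟩

section PairAverage

variable {X : Type*} [TopologicalSpace X] {I : Type*} [Fintype I]

/-- The averaging operator of the diagonal action on functions of two points. -/
noncomputable def pairAverage (F : ProbIFS X I) (φ : X → X → ℝ≥0∞) : X → X → ℝ≥0∞ :=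
  fun x y => ∑ i, (F.prob i : ℝ≥0∞) * φ (F.map i x) (F.map i y)

theorem monotone_pairAverage (F : ProbIFS X I) : Monotone F.pairAverage :=
  fun _ _ h _ _ => Finset.sum_le_sum fun _ _ => mul_le_mul_right (h _ _) _

theorem pairAverage_smul (F : ProbIFS X I) (c : ℝ≥0∞) (φ : X → X → ℝ≥0∞) :
    F.pairAverage (c • φ) = c • F.pairAverage φ := by
  funext x y
  simp only [pairAverage, Pi.smul_apply, smul_eq_mul, Finset.mul_sum]
  exact Finset.sum_congr rfl fun _ _ => mul_left_comm _ _ _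

theorem pairAverage_iterate (F : ProbIFS X I) (n : ℕ) (φ : X → X → ℝ≥0∞) :
    F.pairAverage^[n] φ = (F.iterate n).pairAverage φ := by
  induction n generalizing φ with
  | zero => funext x y; simp [pairAverage, iterate, IFS.iterate, IFS.wordMap]
  | succ n ih =>
    funext x y
    rw [Function.iterate_succ_apply, ih]
    simp only [pairAverage, ← (Fin.consEquiv fun _ : Fin (n + 1) => I).sum_comp,
      Fintype.sum_prod_type_right, Finset.mul_sum]
    refine Finset.sum_congr rfl fun w _ => Finset.sum_congr rfl fun i _ => ?_
    simp [iterate, IFS.iterate, IFS.wordMap, Fin.consEquiv, Fin.prod_univ_succ]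
    ring

theorem pairAverage_iterate_le (F : ProbIFS X I) {φ : X → X → ℝ≥0∞} {c : ℝ≥0∞}
    (h : F.pairAverage φ ≤ c • φ) (n : ℕ) : F.pairAverage^[n] φ ≤ c ^ n • φ := by
  induction n with
  | zero => simp
  | succ n ih =>
    rw [Function.iterate_succ_apply', pow_succ, mul_smul]
    refine (F.monotone_pairAverage ih).trans ?_
    rw [pairAverage_smul]
    exact fun x y => mul_le_mul_right (h x y) _

end PairAverage

section Contraction

variable {X : Type*} [MetricSpace X] {I : Type*} [Fintype I]

theorem pairAverage_edist_le (F : ProbIFS X I) :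
    F.pairAverage edist ≤ (∑ i, (F.prob i : ℝ≥0∞) * lipConst (F.map i)) • edist := fun x y => by
  simp only [pairAverage, Pi.smul_apply, smul_eq_mul, Finset.sum_mul, mul_assoc]
  exact Finset.sum_le_sum fun i _ => mul_le_mul_right (edist_le_lipConst_mul _ _ _) _

theorem tsum_pairAverage_edist_ne_top (F : ProbIFS X I)
    (hLip : ∀ i, ∃ K : ℝ≥0, LipschitzWith K (F.map i)) {k : ℕ} (hk : 1 ≤ k)
    (hcontr : ∑ w, ((F.iterate k).prob w : ℝ≥0∞) * lipConst ((F.iterate k).map w) < 1) (x y : X) :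
    ∑' n, (F.iterate n).pairAverage edist x y ≠ ∞ := by
  choose K hK using hLip
  set c := ∑ w, ((F.iterate k).prob w : ℝ≥0∞) * lipConst ((F.iterate k).map w) with hc
  set C : ℝ≥0 := ∑ i, F.prob i * K i with hC
  have hone : F.pairAverage edist ≤ (C : ℝ≥0∞) • edist := fun x y => by
    simp only [pairAverage, Pi.smul_apply, smul_eq_mul, hC, ENNReal.ofNNReal_finsetSum,
      Finset.sum_mul, ENNReal.coe_mul, mul_assoc]
    exact Finset.sum_le_sum fun i _ => mul_le_mul_right (hK i x y) _
  have : NeZero k := ⟨by omega⟩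
  have hterm : ∀ q r : ℕ, (F.iterate (q * k + r)).pairAverage edist x y ≤
      c ^ q * ((C : ℝ≥0∞) ^ r * edist x y) := fun q r => by
    have h1 := F.pairAverage_iterate_le hone r
    have h2 : F.pairAverage^[k] edist ≤ c • edist := by
      rw [pairAverage_iterate]; exact (F.iterate k).pairAverage_edist_le
    have h3 : F.pairAverage^[q * k] edist ≤ c ^ q • edist := by
      have hk' : F.pairAverage^[k] = (F.iterate k).pairAverage :=
        funext (F.pairAverage_iterate k)
      rw [mul_comm, Function.iterate_mul, hk']
      rw [hk'] at h2
      exact (F.iterate k).pairAverage_iterate_le h2 q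
    have h4 : F.pairAverage^[q * k + r] edist ≤ (C : ℝ≥0∞) ^ r • c ^ q • edist := by
      rw [Function.iterate_add_apply]
      refine (F.monotone_pairAverage.iterate _ h1).trans ?_
      have hs : F.pairAverage^[q * k] ((C : ℝ≥0∞) ^ r • edist) =
          (C : ℝ≥0∞) ^ r • F.pairAverage^[q * k] edist := by
        rw [pairAverage_iterate, pairAverage_smul, ← pairAverage_iterate]
      rw [hs]
      exact fun x y => mul_le_mul_right (h3 x y) _
    rw [pairAverage_iterate] at h4
    refine (h4 x y).trans_eq ?_
    simp only [Pi.smul_apply, smul_eq_mul]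
    ring
  rw [← (Nat.divModEquiv k).symm.tsum_eq, ENNReal.tsum_prod']
  have hsum : ∑' (q : ℕ) (r : Fin k), c ^ q * ((C : ℝ≥0∞) ^ (r : ℕ) * edist x y) ≠ ∞ := by
    simp only [ENNReal.tsum_mul_left, ENNReal.tsum_mul_right, ENNReal.tsum_geometric]
    refine ENNReal.mul_ne_top (ENNReal.inv_ne_top.2 (tsub_pos_of_lt hcontr).ne')
      (ENNReal.mul_ne_top ?_ (edist_ne_top x y))
    rw [tsum_fintype]
    exact ENNReal.sum_ne_top.2 fun r _ => ENNReal.pow_ne_top ENNReal.coe_ne_top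
  exact ne_top_of_le_ne_top hsum (ENNReal.tsum_le_tsum fun q =>
    ENNReal.tsum_le_tsum fun r : Fin k => hterm q r)

end Contraction

/-- The first `n` letters of an infinite word. -/
def wordPrefix {I : Type*} (n : ℕ) (ω : ℕ → I) : Fin n → I := fun j => ω j

theorem measurable_wordPrefix {I : Type*} [MeasurableSpace I] (n : ℕ) : Measurable (wordPrefix (I := I) n) :=
  measurable_pi_lambda _ fun _ => measurable_pi_apply _

section RandomWord

variable {X : Type*} [TopologicalSpace X] {I : Type*} [Fintype I]
  [MeasurableSpace I] [MeasurableSingletonClass I]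

/-- The probability vector of a system as a measure on the index set. -/
noncomputable def symbolMeasure (F : ProbIFS X I) : Measure I :=
  ∑ i, F.prob i • Measure.dirac i

theorem symbolMeasure_singleton (F : ProbIFS X I) (i : I) :
    F.symbolMeasure {i} = F.prob i := by
  classical
  simp only [symbolMeasure, Measure.finsetSum_apply, Measure.smul_apply, Measure.dirac_apply,
    Set.indicator_apply, mem_singleton_iff, ENNReal.smul_def]
  simp

instance (F : ProbIFS X I) : IsProbabilityMeasure F.symbolMeasure := ⟨by
  simp only [symbolMeasure, Measure.finsetSum_apply, Measure.smul_apply, measure_univ,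
    ENNReal.smul_def, smul_eq_mul, mul_one]
  exact_mod_cast F.sum_prob⟩

/-- The law of an infinite random word with independent letters. -/
noncomputable def wordMeasure (F : ProbIFS X I) : Measure (ℕ → I) :=
  Measure.infinitePi fun _ => F.symbolMeasure

instance (F : ProbIFS X I) : IsProbabilityMeasure F.wordMeasure := by
  unfold wordMeasure; infer_instance

theorem wordMeasure_map_prefix_singleton (F : ProbIFS X I) (n : ℕ) (w : Fin n → I) :
    F.wordMeasure.map (wordPrefix n) {w} = (F.iterate n).prob w := by
  rw [Measure.map_apply (measurable_wordPrefix n) (measurableSet_singleton w)]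
  have hset : wordPrefix n ⁻¹' {w} = Set.pi (Finset.range n : Finset ℕ)
      fun j => if h : j < n then {w ⟨j, h⟩} else univ := by
    ext ω
    simp only [mem_preimage, mem_singleton_iff, funext_iff, wordPrefix, Set.mem_pi,
      Finset.coe_range, mem_Iio]
    exact ⟨fun h j hj => by simpa [hj] using h ⟨j, hj⟩,
      fun h j => by simpa using h j j.2⟩
  rw [hset, wordMeasure,
    Measure.infinitePi_pi _ fun j _ => (Set.toFinite _).measurableSet, Finset.prod_range]
  simp [symbolMeasure_singleton, iterate, ENNReal.ofNNReal_finsetProd]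

theorem lintegral_wordPrefix (F : ProbIFS X I) (n : ℕ) (g : (Fin n → I) → ℝ≥0∞) :
    ∫⁻ ω, g (wordPrefix n ω) ∂F.wordMeasure = ∑ w, ((F.iterate n).prob w : ℝ≥0∞) * g w := by
  rw [← lintegral_map (μ := F.wordMeasure) (measurable_of_countable g)
    (measurable_wordPrefix n), lintegral_fintype]
  simp only [wordMeasure_map_prefix_singleton, mul_comm]

theorem integral_wordPrefix (F : ProbIFS X I) (n : ℕ) (g : (Fin n → I) → ℝ) :
    ∫ ω, g (wordPrefix n ω) ∂F.wordMeasure = ∑ w, ((F.iterate n).prob w : ℝ) * g w := by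
  have := Measure.isProbabilityMeasure_map (μ := F.wordMeasure)
    (measurable_wordPrefix (I := I) n).aemeasurable
  rw [← integral_map (μ := F.wordMeasure) (measurable_wordPrefix n).aemeasurable
    (measurable_of_countable g).aestronglyMeasurable, integral_fintype .of_finite]
  simp [Measure.real, wordMeasure_map_prefix_singleton]

end RandomWord

section RandomOrbit

variable {X : Type*} [MetricSpace X] {I : Type*} [Fintype I]

/-- The backward random orbit of the point `x`. -/
def backwardOrbit (F : ProbIFS X I) (x : X) (ω : ℕ → I) (n : ℕ) : X :=
  F.wordMap (wordPrefix n ω) x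

variable [MeasurableSpace I] [MeasurableSingletonClass I]

theorem ae_tsum_edist_backwardOrbit_ne_top (F : ProbIFS X I)
    (h : ∀ x y, ∑' n, (F.iterate n).pairAverage edist x y ≠ ∞) (x y : X) :
    ∀ᵐ ω ∂F.wordMeasure,
      ∑' n, edist (F.backwardOrbit x ω n) (F.backwardOrbit y ω n) ≠ ∞ := by
  have hmeas : ∀ n, Measurable fun ω =>
      edist (F.backwardOrbit x ω n) (F.backwardOrbit y ω n) := fun n =>
    (measurable_of_countable fun w : Fin n → I => edist (F.wordMap w x) (F.wordMap w y)).comp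
      (measurable_wordPrefix n)
  have hint : ∫⁻ ω, ∑' n, edist (F.backwardOrbit x ω n) (F.backwardOrbit y ω n)
      ∂F.wordMeasure ≠ ∞ := by
    rw [lintegral_tsum fun n => (hmeas n).aemeasurable]
    convert! h x y using 3 with n
    exact F.lintegral_wordPrefix n fun w => edist (F.wordMap w x) (F.wordMap w y)
  filter_upwards [ae_lt_top (Measurable.tsum hmeas) hint] with ω hω using hω.ne

theorem ae_exists_tendsto_backwardOrbit [CompleteSpace X] (F : ProbIFS X I)
    (h : ∀ x y, ∑' n, (F.iterate n).pairAverage edist x y ≠ ∞) (x : X) :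
    ∀ᵐ ω ∂F.wordMeasure, ∃ z, Tendsto (F.backwardOrbit x ω) atTop (𝓝 z) := by
  filter_upwards [ae_all_iff.2 fun i => F.ae_tsum_edist_backwardOrbit_ne_top h x (F.map i x)]
    with ω hω
  refine cauchySeq_tendsto_of_complete (cauchySeq_of_edist_le_of_tsum_ne_top
    (fun n => ∑ i, edist (F.backwardOrbit x ω n) (F.backwardOrbit (F.map i x) ω n))
    (fun n => ?_) ?_)
  · have hstep : F.backwardOrbit x ω (n + 1) = F.backwardOrbit (F.map (ω n) x) ω n :=
      F.wordMap_eq_init_last (wordPrefix (n + 1) ω) x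
    rw [Nat.succ_eq_add_one, hstep]
    exact Finset.single_le_sum
      (f := fun i => edist (F.backwardOrbit x ω n) (F.backwardOrbit (F.map i x) ω n))
      (fun _ _ => zero_le) (Finset.mem_univ (ω n))
  · rw [Summable.tsum_finsetSum fun _ _ => ENNReal.summable]
    exact ENNReal.sum_ne_top.2 fun i _ => hω i

/-- Summability of the mean distances between orbits makes all backward random orbits converge
almost surely to one random point. -/
theorem exists_random_limit [CompleteSpace X] [Nonempty X] [MeasurableSpace X] [BorelSpace X]
    (F : ProbIFS X I) (h : ∀ x y, ∑' n, (F.iterate n).pairAverage edist x y ≠ ∞) :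
    ∃ Z : (ℕ → I) → X, AEMeasurable Z F.wordMeasure ∧
      ∀ x, ∀ᵐ ω ∂F.wordMeasure, Tendsto (F.backwardOrbit x ω) atTop (𝓝 (Z ω)) := by
  obtain ⟨x₀⟩ := ‹Nonempty X›
  have hmeas : ∀ n, Measurable fun ω => F.backwardOrbit x₀ ω n := fun n =>
    (measurable_of_countable fun w : Fin n → I => F.wordMap w x₀).comp (measurable_wordPrefix n)
  obtain ⟨Z, hZm, hZ⟩ := measurable_limit_of_tendsto_metrizable_ae
    (fun n => (hmeas n).aemeasurable) (F.ae_exists_tendsto_backwardOrbit h x₀)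
  refine ⟨Z, hZm.aemeasurable, fun x => ?_⟩
  filter_upwards [hZ, F.ae_tsum_edist_backwardOrbit_ne_top h x₀ x] with ω h₁ h₂
  refine h₁.congr_dist ?_
  have := (ENNReal.tendsto_toReal ENNReal.zero_ne_top).comp
    (ENNReal.tendsto_atTop_zero_of_tsum_ne_top h₂)
  simpa [Function.comp_def, dist_edist] using this

end RandomOrbit

theorem exists_isAsymptoticallyStableMeasure {X : Type*} [MetricSpace X] [CompleteSpace X]
    [Nonempty X] [MeasurableSpace X] [BorelSpace X] {I : Type*} [Fintype I]
    (F : ProbIFS X I) (h : ∀ x y, ∑' n, (F.iterate n).pairAverage edist x y ≠ ∞) :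
    ∃ μ, IsAsymptoticallyStableMeasure F.markov μ := by
  let _ : MeasurableSpace I := ⊤
  obtain ⟨Z, hZm, hZ⟩ := F.exists_random_limit h
  refine ⟨⟨F.wordMeasure.map Z, Measure.isProbabilityMeasure_map hZm⟩, fun ν =>
    ProbabilityMeasure.tendsto_iff_forall_integral_tendsto.2 fun g => ?_⟩
  rw [ProbabilityMeasure.coe_mk, integral_map hZm g.continuous.measurable.aestronglyMeasurable]
  have hpoint : ∀ x, Tendsto (fun n => ∑ w, ((F.iterate n).prob w : ℝ) * g (F.wordMap w x)) atTop
      (𝓝 (∫ ω, g (Z ω) ∂F.wordMeasure)) := fun x => by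
    simp only [← F.integral_wordPrefix _ fun w => g (F.wordMap w x)]
    refine tendsto_integral_of_dominated_convergence (fun _ => ‖g‖) (fun n => ?_)
      (integrable_const _) (fun n => ae_of_all _ fun ω => g.norm_coe_le_norm _) ?_
    · exact ((measurable_of_countable fun w : Fin n → I => g (F.wordMap w x)).comp
        (measurable_wordPrefix n)).aestronglyMeasurable
    · filter_upwards [hZ x] with ω hω using (g.continuous.tendsto _).comp hω
  have hmarkov : ∀ n, ∫ x, g x ∂(F.markov^[n] ν : Measure X) =
      ∫ x, ∑ w, ((F.iterate n).prob w : ℝ) * g (F.wordMap w x) ∂(ν : Measure X) := fun n => by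
    rw [← iterate_markov, integral_markov, integral_finsetSum]
    · exact Finset.sum_congr rfl fun w _ => (integral_const_mul _ _).symm
    · exact fun w _ =>
        ((g.compContinuous ⟨_, F.continuous_wordMap w⟩).integrable (ν : Measure X)).const_mul _
  have hconst : ∫ ω, g (Z ω) ∂F.wordMeasure =
      ∫ _, (∫ ω, g (Z ω) ∂F.wordMeasure) ∂(ν : Measure X) := by simp
  simp only [hmarkov]
  rw [hconst]
  refine tendsto_integral_of_dominated_convergence (fun _ => ‖g‖) (fun n => ?_)
    (integrable_const _) (fun n => ae_of_all _ fun x => ?_) (ae_of_all _ hpoint)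
  · exact (continuous_finsetSum _ fun w _ => continuous_const.mul
      (g.continuous.comp (F.continuous_wordMap w))).measurable.aestronglyMeasurable
  · refine (norm_sum_le _ _).trans ?_
    calc ∑ w, ‖((F.iterate n).prob w : ℝ) * g (F.wordMap w x)‖
        ≤ ∑ w, ((F.iterate n).prob w : ℝ) * ‖g‖ := Finset.sum_le_sum fun w _ => by
          rw [norm_mul, NNReal.norm_eq]
          exact mul_le_mul_of_nonneg_left (g.norm_coe_le_norm _) (NNReal.coe_nonneg _)
      _ = ‖g‖ := by
          rw [← Finset.sum_mul, ← NNReal.coe_sum, (F.iterate n).sum_prob, NNReal.coe_one, one_mul]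

end ProbIFS

theorem mainTheorem2 {X : Type*} [MetricSpace X] [CompleteSpace X]
    [TopologicalSpace.SeparableSpace X] [Nonempty X] [MeasurableSpace X] [BorelSpace X]
    {I : Type*} [Fintype I] (F : ProbIFS X I)
    (hpos : ∀ i, 0 < F.prob i)
    (hLip : ∀ i, ∃ K : ℝ≥0, LipschitzWith K (F.map i))
    (k : ℕ) (hk : 1 ≤ k)
    (hcontr : ∑ w : Fin k → I,
      ((F.iterate k).prob w : ℝ≥0∞) * lipConst ((F.iterate k).map w) < 1) :
    (F.iterate k).markov = F.markov^[k] ∧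
    ∃ (A : Set X) (μ : ProbabilityMeasure X),
      F.toIFS.IsSemiattractor A ∧
      (F.iterate k).toIFS.IsSemiattractor A ∧
      IsAsymptoticallyStableMeasure F.markov μ ∧
      IsAsymptoticallyStableMeasure (F.iterate k).markov μ ∧
      IsUniqueInvariantMeasure F.markov μ ∧
      IsUniqueInvariantMeasure (F.iterate k).markov μ ∧
      (μ : Measure X).support = A := by
  have : SecondCountableTopology X := UniformSpace.secondCountable_of_separable X
  obtain ⟨μ, hμ⟩ := F.exists_isAsymptoticallyStableMeasure
    (F.tsum_pairAverage_edist_ne_top hLip hk hcontr)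
  have hμk : IsAsymptoticallyStableMeasure (F.iterate k).markov μ := by
    rw [F.iterate_markov]
    exact hμ.iterate hk
  exact ⟨F.iterate_markov k, _, μ, F.isSemiattractor_support hpos hμ,
    (F.iterate k).isSemiattractor_support (fun w => Finset.prod_pos fun l _ => hpos (w l)) hμk,
    hμ, hμk,
    hμ.isUniqueInvariantMeasure (hμ.isFixedPt F.continuous_markov),
    hμk.isUniqueInvariantMeasure (hμk.isFixedPt (F.iterate k).continuous_markov), rfl⟩
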